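/- Let $A,J\in\mathbb{R}^{n\times n}$, $B_c\in\mathbb{R}^{n\times m_c}$, $B_d\in\mathbb{R}^{n\times m_d}$ and $\bar T>0$. Consider the impulsive system $$\dot x(t)=Ax(t)+B_cu_c(t)\ (t\ne t_k),\qquad x(t^+)=Jx(t)+B_du_d(t)\ (t=t_k),$$ with left-continuous trajectories on $[t_0,\infty)$, and the clock-dependent controller $$u_c(t_k+\tau)=\begin{cases}K_c(\tau)x(t_k+\tau),&\tau\in[0,\bar T),\\ K_c(\bar T)x(t_k+\tau),&\tau\in[\bar T,T_k),\end{cases}\qquad u_d(t_k)=K_dx(t_k),\qquad(\ast)$$ where $T_k=t_{k+1}-t_k$, $K_c:[0,\bar T]\to\mathbb{R}^{m_c\times n}$ is continuous and $K_d\in\mathbb{R}^{m_d\times n}$. The closed loop is called positive and asymptotically stable under minimum dwell-time $\bar T$ if, for every sequence $(t_k)_{k\ge0}$ with $T_k\ge\bar T$ for all $k$ (whether or not an impulse acts at the initial time $t_0$), $x(t_0)\ge0$ implies $x(t)\ge0$ for all $t\ge t_0$, and the origin is Lyapunov stable and globally attractive. Vector inequalities, and matrix inequalities $M\ge0$, are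 entrywise; a matrix is Metzler if its off-diagonal entries are nonnegative; $\mathbf 1$ is the vector of ones. Then the following two statements are equivalent, and if one of them holds, there exists a controller of the form $(\ast)$ such that the closed-loop system is positive and asymptotically stable under minimum dwell-time $\bar T$. (a) There exist $\lambda\in\mathbb{R}^n$ with $\lambda>0$, a continuous $K_c:[0,\bar T]\to\mathbb{R}^{m_c\times n}$ and $K_d\in\mathbb{R}^{m_d\times n}$ such that $A+B_cK_c(\tau)$ is Metzler for all $\tau\in[0,\bar T]$, $J+B_dK_d\ge0$, $$(A+B_cK_c(\bar T))\lambda<0\quad\text{and}\quad[\Psi(\bar T)(J+B_dK_d)-I_n]\lambda<0,$$ where $\frac{d\Psi(s)}{ds}=(A+B_cK_c(s))\Psi(s)$ for $s\ge0$, $\Psi(0)=I_n$, with $K_c(s):=K_c(\bar T)$ for $s\ge\bar T$. (b) There exist a differentiable $X:[0,\bar T]\to\mathbb{R}^{n\times n}$ with $X(\tau)$ diagonal and nonsingular for all $\tau\in[0,\bar T]$ and $X(\bar T)$ having positive diagonal entries, a continuous $U:[0,\bar T]\to\mathbb{R}^{m_c\times n}$, a matrix $U_d\in\mathbb{R}^{m_d\times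 n}$ and scalars $\varepsilon,\alpha>0$ such that, for all $\tau\in[0,\bar T]$, $$AX(\tau)+B_cU(\tau)+\alpha I_n\ge0,\qquad JX(\bar T)+B_dU_d\ge0,\qquad[AX(\bar T)+B_cU(\bar T)]\mathbf 1<0,$$ $$[-\dot X(\tau)+AX(\tau)+B_cU(\tau)]\mathbf 1<0,\qquad[JX(\bar T)+B_dU_d-X(0)+\varepsilon I_n]\mathbf 1\le0.$$ Moreover, suitable controller gains are the $K_c,K_d$ of any solution of (a), and, for any solution of (b), $K_c(\tau)=U(\tau)X(\tau)^{-1}$ and $K_d=U_dX(\bar T)^{-1}$. -/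

import Mathlib

open Set Filter Topology
open scoped Matrix

namespace ImpulsiveStabilization

/-- A real square matrix is Metzler if its off-diagonal entries are nonnegative. -/
def IsMetzler {n : ℕ} (M : Matrix (Fin n) (Fin n) ℝ) : Prop :=
  ∀ i j, i ≠ j → 0 ≤ M i j

/-- Entrywise nonnegativity of a matrix. -/
def IsNonneg {n m : ℕ} (M : Matrix (Fin n) (Fin m) ℝ) : Prop :=
  ∀ i j, 0 ≤ M i j

/-- Strict componentwise negativity of a vector, written `v < 0` in the positive systems
literature. -/
def IsNeg {n : ℕ} (v : Fin n → ℝ) : Prop :=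
  ∀ i, v i < 0

/-- Componentwise nonpositivity of a vector. -/
def IsNonpos {n : ℕ} (v : Fin n → ℝ) : Prop :=
  ∀ i, v i ≤ 0

/-- The gain at clock value `τ`: it is `K τ` for `τ < T` and is frozen at `K T` from `T` on. -/
noncomputable def clockGain {n m : ℕ} (T : ℝ) (K : ℝ → Matrix (Fin m) (Fin n) ℝ) (τ : ℝ) :
    Matrix (Fin m) (Fin n) ℝ :=
  if τ < T then K τ else K T

/-- Left-continuous trajectories `x` on `[t 0, ∞)` of the impulsive system
`x' = A x + Bc uc` away from the impulse times, `x(t⁺) = J x(t) + Bd ud(t)` at the impulse times.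
At the initial time `t 0` an impulse may or may not act: both conventions are covered. -/
structure IsTrajectory {n mc md : ℕ} (A : Matrix (Fin n) (Fin n) ℝ)
    (Bc : Matrix (Fin n) (Fin mc) ℝ) (J : Matrix (Fin n) (Fin n) ℝ)
    (Bd : Matrix (Fin n) (Fin md) ℝ) (t : ℕ → ℝ) (uc : ℝ → Fin mc → ℝ) (ud : ℝ → Fin md → ℝ)
    (x : ℝ → Fin n → ℝ) : Prop where
  flow : ∀ k, ∀ s ∈ Ioo (t k) (t (k + 1)), HasDerivAt x (A *ᵥ x s + Bc *ᵥ uc s) s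
  leftCont : ∀ k, ContinuousWithinAt x (Iic (t (k + 1))) (t (k + 1))
  jump : ∀ k, Tendsto x (𝓝[>] t (k + 1)) (𝓝 (J *ᵥ x (t (k + 1)) + Bd *ᵥ ud (t (k + 1))))
  start : Tendsto x (𝓝[>] t 0) (𝓝 (J *ᵥ x (t 0) + Bd *ᵥ ud (t 0))) ∨
    Tendsto x (𝓝[>] t 0) (𝓝 (x (t 0)))

/-- The inputs are generated by the clock-dependent state feedback with gains `Kc` (frozen once
the time elapsed since the last impulse reaches `T`) and `Kd`. -/
structure IsClockFeedback {n mc md : ℕ} (T : ℝ) (Kc : ℝ → Matrix (Fin mc) (Fin n) ℝ)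
    (Kd : Matrix (Fin md) (Fin n) ℝ) (t : ℕ → ℝ) (x : ℝ → Fin n → ℝ)
    (uc : ℝ → Fin mc → ℝ) (ud : ℝ → Fin md → ℝ) : Prop where
  cont : ∀ k, ∀ τ ∈ Ico 0 (t (k + 1) - t k), uc (t k + τ) = clockGain T Kc τ *ᵥ x (t k + τ)
  disc : ∀ k, ud (t k) = Kd *ᵥ x (t k)

/-- Trajectories of the closed-loop system. -/
def IsClosedLoopTrajectory {n mc md : ℕ} (A : Matrix (Fin n) (Fin n) ℝ)
    (Bc : Matrix (Fin n) (Fin mc) ℝ) (J : Matrix (Fin n) (Fin n) ℝ)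
    (Bd : Matrix (Fin n) (Fin md) ℝ) (T : ℝ) (Kc : ℝ → Matrix (Fin mc) (Fin n) ℝ)
    (Kd : Matrix (Fin md) (Fin n) ℝ) (t : ℕ → ℝ) (x : ℝ → Fin n → ℝ) : Prop :=
  ∃ (uc : ℝ → Fin mc → ℝ) (ud : ℝ → Fin md → ℝ),
    IsTrajectory A Bc J Bd t uc ud x ∧ IsClockFeedback T Kc Kd t x uc ud

/-- Sequences of impulse times whose dwell-times are at least `T`. For `T > 0` they are strictly
increasing and unbounded. -/
def HasMinDwellTime (T : ℝ) (t : ℕ → ℝ) : Prop :=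
  ∀ k, T ≤ t (k + 1) - t k

/-- A set of trajectories starting at time `t₀` is positive if nonnegative initial states yield
nonnegative trajectories. -/
def IsPositiveSystem {n : ℕ} (S : Set (ℝ → Fin n → ℝ)) (t₀ : ℝ) : Prop :=
  ∀ x ∈ S, (∀ i, 0 ≤ x t₀ i) → ∀ s, t₀ ≤ s → ∀ i, 0 ≤ x s i

/-- Asymptotic stability of the origin: Lyapunov stability together with global attractivity. -/
def IsAsymptoticallyStable {n : ℕ} (S : Set (ℝ → Fin n → ℝ)) (t₀ : ℝ) : Prop :=
  (∀ ε > 0, ∃ δ > 0, ∀ x ∈ S, ‖x t₀‖ < δ → ∀ s, t₀ ≤ s → ‖x s‖ < ε) ∧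
    ∀ x ∈ S, Tendsto x atTop (𝓝 0)

/-- The controller with gains `Kc`, `Kd` (where `Kc` is continuous, so that the closed-loop
differential equation is well posed) renders the closed-loop system positive and asymptotically
stable under minimum dwell-time `T`, i.e. for every admissible sequence of impulse times. -/
def IsStabilizing {n mc md : ℕ} (A : Matrix (Fin n) (Fin n) ℝ)
    (Bc : Matrix (Fin n) (Fin mc) ℝ) (J : Matrix (Fin n) (Fin n) ℝ)
    (Bd : Matrix (Fin n) (Fin md) ℝ) (T : ℝ) (Kc : ℝ → Matrix (Fin mc) (Fin n) ℝ)
    (Kd : Matrix (Fin md) (Fin n) ℝ) : Prop :=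
  ContinuousOn Kc (Icc 0 T) ∧
    ∀ t : ℕ → ℝ, HasMinDwellTime T t →
      IsPositiveSystem {x | IsClosedLoopTrajectory A Bc J Bd T Kc Kd t x} (t 0) ∧
      IsAsymptoticallyStable {x | IsClosedLoopTrajectory A Bc J Bd T Kc Kd t x} (t 0)

/-- `Ψ` is the state-transition matrix of the flow from clock value `0`:
`Ψ' = (A + Bc Kc) Ψ` on `[0, ∞)`, `Ψ 0 = I` (with `Kc` frozen from `T` on). -/
def IsTransitionMatrix {n mc : ℕ} (A : Matrix (Fin n) (Fin n) ℝ)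
    (Bc : Matrix (Fin n) (Fin mc) ℝ) (T : ℝ) (Kc : ℝ → Matrix (Fin mc) (Fin n) ℝ)
    (Ψ : ℝ → Matrix (Fin n) (Fin n) ℝ) : Prop :=
  Ψ 0 = 1 ∧
    ∀ s, 0 ≤ s → HasDerivWithinAt Ψ ((A + Bc * clockGain T Kc s) * Ψ s) (Ici 0) s

/-- The transition-matrix condition for given `lam`, `Kc`, `Kd`. -/
structure TransitionCondition {n mc md : ℕ} (A : Matrix (Fin n) (Fin n) ℝ)
    (Bc : Matrix (Fin n) (Fin mc) ℝ) (J : Matrix (Fin n) (Fin n) ℝ)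
    (Bd : Matrix (Fin n) (Fin md) ℝ) (T : ℝ) (lam : Fin n → ℝ)
    (Kc : ℝ → Matrix (Fin mc) (Fin n) ℝ) (Kd : Matrix (Fin md) (Fin n) ℝ) : Prop where
  cont : ContinuousOn Kc (Icc 0 T)
  pos : ∀ i, 0 < lam i
  metzler : ∀ τ ∈ Icc 0 T, IsMetzler (A + Bc * Kc τ)
  nonneg : IsNonneg (J + Bd * Kd)
  flow : IsNeg ((A + Bc * Kc T) *ᵥ lam)
  transition : ∃ Ψ : ℝ → Matrix (Fin n) (Fin n) ℝ, IsTransitionMatrix A Bc T Kc Ψ ∧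
    IsNeg ((Ψ T * (J + Bd * Kd) - 1) *ᵥ lam)

/-- The clock-dependent linear program for given `X`, `U`, `Ud`, `ε`, `α`. The vector of ones is
`1`. Invertibility of all `X τ` is what makes the gain `U τ * (X τ)⁻¹` meaningful. -/
structure LPCondition {n mc md : ℕ} (A : Matrix (Fin n) (Fin n) ℝ)
    (Bc : Matrix (Fin n) (Fin mc) ℝ) (J : Matrix (Fin n) (Fin n) ℝ)
    (Bd : Matrix (Fin n) (Fin md) ℝ) (T : ℝ) (X : ℝ → Matrix (Fin n) (Fin n) ℝ)
    (U : ℝ → Matrix (Fin mc) (Fin n) ℝ) (Ud : Matrix (Fin md) (Fin n) ℝ) (ε α : ℝ) : Prop where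
  diag : ∀ τ ∈ Icc 0 T, (X τ).IsDiag
  diff : DifferentiableOn ℝ X (Icc 0 T)
  cont : ContinuousOn U (Icc 0 T)
  unit : ∀ τ ∈ Icc 0 T, IsUnit (X τ)
  pos : ∀ i, 0 < X T i i
  eps_pos : 0 < ε
  alpha_pos : 0 < α
  metzler : ∀ τ ∈ Icc 0 T, IsNonneg (A * X τ + Bc * U τ + α • (1 : Matrix (Fin n) (Fin n) ℝ))
  nonneg : IsNonneg (J * X T + Bd * Ud)
  flow_end : IsNeg ((A * X T + Bc * U T) *ᵥ 1)
  flow : ∀ τ ∈ Icc 0 T, IsNeg ((-derivWithin X (Icc 0 T) τ + A * X τ + Bc * U τ) *ᵥ 1)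
  jump : IsNonpos ((J * X T + Bd * Ud - X 0 + ε • (1 : Matrix (Fin n) (Fin n) ℝ)) *ᵥ 1)

end ImpulsiveStabilization

namespace ImpulsiveStabilization

/-! Put `M τ = A + Bc * Kc τ`, a Metzler matrix, and `P = J + Bd * Kd`, a nonnegative one. Each
condition amounts to the existence of a curve `ξ` of positive vectors on `[0, T]` with `M ξ < ξ'`,
`M T ξ(T) < 0` and `P ξ(T) + ε 1 ≤ ξ(0)`. The tool throughout is `nonneg_of_metzler_supersolution`:
a Metzler flow preserves order, so a supersolution stays above every solution that starts below it.

The linear program is this statement in the variables `X = diag ξ`, `U = Kc X`, `Ud = Kd X(T)`,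
which make it linear. A transition condition yields `ξ` by adding a growing exponential to a
solution of the flow, with terminal value `lam` (`TransitionCondition.exists_strictSupersolution`).
Conversely, with `lam = ξ(T)`, comparing the flow with `ξ` gives `Ψ(T)(P lam + ε 1) ≤ lam`, and
positivity of `Ψ(T) 1` makes the required inequality strict (`LPCondition.transitionCondition`).

For stability, the order interval `[-c ξ, c ξ]` traps trajectories on `[0, T]`. Beyond `T` the
constant `c ξ(T)` still bounds them, because `M T ξ(T) ≤ 0`, so arbitrarily long dwell-times do no
harm. Each jump shrinks the interval by a fixed factor `ρ < 1`, whence geometric decay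
(`exists_norm_le_geometric`). Positivity is the same comparison with zero. -/

/-! ### Entry bounds and the comparison principle for Metzler coefficients. -/

theorem exists_entry_bound {n m : ℕ} {M : ℝ → Matrix (Fin n) (Fin m) ℝ} {a b : ℝ}
    (hM : ContinuousOn M (Icc a b)) :
    ∃ C, 0 ≤ C ∧ ∀ s ∈ Icc a b, ∀ i j, |M s i j| ≤ C := by
  obtain ⟨C, hC⟩ := isCompact_Icc.exists_bound_of_continuousOn
    (f := fun s => (show Fin n → Fin m → ℝ from M s)) hM
  refine ⟨max C 0, le_max_right _ _, fun s hs i j => ?_⟩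
  exact ((norm_le_pi_norm (show Fin m → ℝ from M s i) j).trans
    ((norm_le_pi_norm (show Fin n → Fin m → ℝ from M s) i).trans (hC s hs))).trans (le_max_left _ _)

theorem abs_mulVec_le {n m : ℕ} {M : Matrix (Fin n) (Fin m) ℝ} {C : ℝ}
    (hM : ∀ i j, |M i j| ≤ C) {x : Fin m → ℝ} {r : ℝ} (hx : ∀ j, |x j| ≤ r) (i : Fin n) :
    |(M *ᵥ x) i| ≤ m * C * r := by
  simp only [Matrix.mulVec, dotProduct]
  refine (Finset.abs_sum_le_sum_abs _ _).trans ?_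
  calc ∑ j, |M i j * x j| ≤ ∑ _j : Fin m, C * r := by
        refine Finset.sum_le_sum fun j _ => ?_
        rw [abs_mul]
        exact mul_le_mul (hM i j) (hx j) (abs_nonneg _) ((abs_nonneg _).trans (hM i j))
    _ = m * C * r := by simp; ring

theorem norm_mulVec_le {n m : ℕ} {M : Matrix (Fin n) (Fin m) ℝ} {C : ℝ} (hC : 0 ≤ C)
    (hM : ∀ i j, |M i j| ≤ C) (x : Fin m → ℝ) : ‖M *ᵥ x‖ ≤ m * C * ‖x‖ :=
  (pi_norm_le_iff_of_nonneg (by positivity)).2 fun i =>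
    abs_mulVec_le hM (fun j => norm_le_pi_norm x j) i

theorem eventually_pos_right_of_hasDerivAt {f : ℝ → ℝ} {f' s : ℝ} (h : HasDerivAt f f' s)
    (hs : f s = 0) (hf' : 0 < f') : ∀ᶠ t in 𝓝[>] s, 0 < f t := by
  have h1 := (hasDerivAt_iff_tendsto_slope.1 h).mono_left
    (nhdsWithin_mono s (fun t (ht : s < t) => ne_of_gt ht))
  filter_upwards [h1.eventually (lt_mem_nhds hf'), self_mem_nhdsWithin] with t ht hst
  rw [slope_def_field, hs, sub_zero] at ht
  exact (div_pos_iff_of_pos_right (sub_pos.2 hst)).1 ht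

/-- Supersolutions of a linear differential equation with Metzler coefficients stay nonnegative. -/
theorem nonneg_of_metzler_supersolution {n : ℕ} {a b C : ℝ} {M : ℝ → Matrix (Fin n) (Fin n) ℝ}
    {z w : ℝ → Fin n → ℝ} (hM : ∀ s ∈ Ioo a b, IsMetzler (M s))
    (hC : ∀ s ∈ Ioo a b, ∀ i j, |M s i j| ≤ C) (hz : ContinuousOn z (Icc a b))
    (hz' : ∀ s ∈ Ioo a b, HasDerivAt z (w s) s)
    (hw : ∀ s ∈ Ioo a b, ∀ i, (M s *ᵥ z s) i ≤ w s i) (ha : ∀ i, 0 ≤ z a i) :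
    ∀ s ∈ Icc a b, ∀ i, 0 ≤ z s i := by
  have key : ∀ η > 0, ∀ s ∈ Icc a b, ∀ i, 0 ≤ z s i + η * Real.exp ((n * C + 1) * (s - a)) := by
    intro η hη
    -- Row sums of `M` are at most `n * C`, so the rate `L` beats them by one: adding `η * exp (L *
    -- (s - a))` makes the differential inequality strict. A vanishing coordinate of `y` then has
    -- positive derivative, and `y` cannot leave the nonnegative orthant. Finally `η → 0`.
    set L : ℝ := n * C + 1 with hL
    set y : ℝ → Fin n → ℝ := fun s i => z s i + η * Real.exp (L * (s - a)) with hy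
    have hyc : ContinuousOn y (Icc a b) := by
      refine continuousOn_pi.2 fun i => ((continuousOn_pi.1 hz) i).add ?_
      fun_prop
    suffices h : Icc a b ⊆ {s | ∀ i, 0 ≤ y s i} from fun s hs i => h hs i
    refine IsClosed.Icc_subset_of_forall_exists_gt ?_ ?_ ?_
    · have := hyc.preimage_isClosed_of_isClosed isClosed_Icc (isClosed_Ici (a := (0 : Fin n → ℝ)))
      rw [inter_comm] at this
      exact this
    · intro i
      have := ha i
      simp only [hy]
      positivity
    · rintro s ⟨hs, hsab⟩ u hu
      have hev : ∀ᶠ t in 𝓝[>] s, ∀ i, 0 ≤ y t i := by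
        refine eventually_all.2 fun i => ?_
        rcases (hs i).lt_or_eq with hpos | hzero
        · have hc : ContinuousWithinAt (fun t => y t i) (Ioc s b) s :=
            ((continuousOn_pi.1 hyc i) s ⟨hsab.1, hsab.2.le⟩).mono
              fun t ht => ⟨hsab.1.trans ht.1.le, ht.2⟩
          have hc' := hc.eventually (lt_mem_nhds hpos)
          rw [nhdsWithin_Ioc_eq_nhdsGT hsab.2] at hc'
          exact hc'.mono fun t ht => ht.le
        -- The perturbation is strictly positive at `a`, so a coordinate can vanish only at an
        -- interior time, where the derivative is available.
        · have hsa : a ≠ s := by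
            rintro rfl
            have h1 := ha i
            have : 0 < y a i := by simp only [hy]; positivity
            exact this.ne hzero
          have hs' : s ∈ Ioo a b := ⟨lt_of_le_of_ne hsab.1 hsa, hsab.2⟩
          have hd : HasDerivAt (fun t => y t i)
              (w s i + η * (Real.exp (L * (s - a)) * L)) s := by
            refine (hasDerivAt_pi.1 (hz' s hs') i).add (HasDerivAt.const_mul η ?_)
            have : HasDerivAt (fun t => L * (t - a)) L s := by
              simpa using ((hasDerivAt_id s).sub_const a).const_mul L
            exact this.exp
          refine (eventually_pos_right_of_hasDerivAt hd hzero.symm ?_).mono fun t ht => ht.le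
          have h1 : (M s *ᵥ y s) i = (M s *ᵥ z s) i
              + (M s *ᵥ (1 : Fin n → ℝ)) i * (η * Real.exp (L * (s - a))) := by
            simp only [Matrix.mulVec, dotProduct, hy, mul_add, Finset.sum_add_distrib,
              Finset.sum_mul, Pi.one_apply, mul_one]
          have h2 : 0 ≤ (M s *ᵥ y s) i := by
            change 0 ≤ ∑ j, M s i j * y s j
            -- The diagonal entry has no sign, but it multiplies the coordinate that vanishes.
            refine Finset.sum_nonneg fun j _ => ?_
            by_cases hij : i = j
            · subst hij; simp [← hzero]
            · exact mul_nonneg (hM s hs' i j hij) (hs j)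
          have h3 := abs_le.1 (abs_mulVec_le (hC s hs') (x := (1 : Fin n → ℝ)) (r := 1)
            (fun j => by simp) i)
          have h4 := hw s hs' i
          have he : 0 < η * Real.exp (L * (s - a)) := by positivity
          have h5 : (M s *ᵥ (1 : Fin n → ℝ)) i * (η * Real.exp (L * (s - a)))
              ≤ (L - 1) * (η * Real.exp (L * (s - a))) :=
            mul_le_mul_of_nonneg_right (by rw [hL]; linarith [h3.2]) he.le
          linarith
      obtain ⟨t, ht, htu⟩ := (hev.and (Ioc_mem_nhdsGT hu)).exists
      exact ⟨t, ht, htu⟩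
  intro s hs i
  have hlim : Tendsto (fun η : ℝ => z s i + η * Real.exp ((n * C + 1) * (s - a))) (𝓝[>] 0)
      (𝓝 (z s i)) := by
    have : Continuous fun η : ℝ => z s i + η * Real.exp ((n * C + 1) * (s - a)) := by fun_prop
    simpa using (this.tendsto 0).mono_left nhdsWithin_le_nhds
  exact ge_of_tendsto hlim (eventually_nhdsWithin_of_forall fun η hη => key η hη s hs i)

/-! ### Existence and uniqueness for linear differential equations. -/

/-- A nonautonomous linear differential equation has a solution on every compact interval. -/
theorem exists_linear_ode_solution_Icc {n : ℕ} {M : ℝ → Matrix (Fin n) (Fin n) ℝ} {b : ℝ}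
    (hb : 0 ≤ b) (hM : ContinuousOn M (Icc 0 b)) (v : Fin n → ℝ) :
    ∃ ψ : ℝ → Fin n → ℝ, ψ 0 = v ∧
      ∀ s ∈ Icc 0 b, HasDerivWithinAt ψ (M s *ᵥ ψ s) (Icc 0 b) s := by
  obtain ⟨C, hC0, hC⟩ := exists_entry_bound hM
  have hop : ∀ s ∈ Icc 0 b, ∀ x, ‖M s *ᵥ x‖ ≤ n * C * ‖x‖ := fun s hs x =>
    norm_mulVec_le hC0 (hC s hs) x
  set K : NNReal := ⟨n * C, by positivity⟩ with hK
  -- `R` is the Grönwall bound for a solution starting at `v`. Truncating the state at `R` makes the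
  -- field globally bounded, so Picard–Lindelöf covers all of `[0, b]` at once; Grönwall then shows
  -- that the truncation never acts.
  set R : ℝ := ‖v‖ * Real.exp (n * C * b) with hR
  have hR0 : 0 ≤ R := by positivity
  set cl : (Fin n → ℝ) → Fin n → ℝ := fun x i => max (-R) (min R (x i)) with hcl
  have hcl_lip : ∀ x y, ‖cl x - cl y‖ ≤ ‖x - y‖ := fun x y => by
    refine (pi_norm_le_iff_of_nonneg (norm_nonneg _)).2 fun i => ?_
    refine le_trans ?_ (norm_le_pi_norm (x - y) i)
    simp only [hcl, Pi.sub_apply, Real.norm_eq_abs]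
    refine (abs_max_sub_max_le_max _ _ _ _).trans (max_le (by simp) ?_)
    exact (abs_min_sub_min_le_max _ _ _ _).trans (max_le (by simp) le_rfl)
  have hcl_norm : ∀ x, ‖cl x‖ ≤ R := fun x => by
    refine (pi_norm_le_iff_of_nonneg hR0).2 fun i => abs_le.2 ⟨le_max_left _ _, ?_⟩
    exact max_le (by linarith) (min_le_left _ _)
  have hcl_le : ∀ x, ‖cl x‖ ≤ ‖x‖ := fun x => by
    have h0 : cl 0 = 0 := by ext i; simp [hcl, hR0]
    simpa [h0] using hcl_lip x 0
  have hcl_eq : ∀ x, ‖x‖ ≤ R → cl x = x := fun x hx => by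
    ext i
    have := abs_le.1 ((norm_le_pi_norm x i).trans hx)
    simp only [hcl]
    rw [min_eq_right this.2, max_eq_right this.1]
  have hPL : IsPicardLindelof (fun s x => M s *ᵥ cl x) (⟨0, le_rfl, hb⟩ : Icc 0 b) v
      ⟨n * C * R * b, by positivity⟩ 0 ⟨n * C * R, by positivity⟩ K := by
    refine ⟨fun s hs => ?_, fun x _ => ?_, fun s hs x _ => ?_, ?_⟩
    · refine (LipschitzWith.of_dist_le_mul fun x y => ?_).lipschitzOnWith
      rw [dist_eq_norm, dist_eq_norm, ← Matrix.mulVec_sub]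
      refine (hop s hs _).trans ?_
      exact mul_le_mul_of_nonneg_left (hcl_lip x y) (by positivity)
    · exact (continuous_id.matrix_mulVec continuous_const).comp_continuousOn hM
    · exact (hop s hs _).trans (mul_le_mul_of_nonneg_left (hcl_norm x) (by positivity))
    · simp only [sub_zero, sub_self, hb, sup_of_le_left, NNReal.coe_zero]
      exact le_rfl
  obtain ⟨ψ, h0, hψ⟩ := hPL.exists_eq_forall_mem_Icc_hasDerivWithinAt₀
  simp only at h0
  refine ⟨ψ, h0, fun s hs => ?_⟩
  have hbound : ‖ψ s‖ ≤ R := by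
    have h1 := norm_le_gronwallBound_of_norm_deriv_right_le (f := ψ)
      (f' := fun s => M s *ᵥ cl (ψ s)) (δ := ‖v‖) (K := n * C) (ε := 0) (a := 0) (b := b)
      (fun s hs => (hψ s hs).continuousWithinAt)
      (fun s hs => ((hψ s ⟨hs.1, hs.2.le⟩).mono_of_mem_nhdsWithin
        (Icc_mem_nhdsGE_of_mem hs)))
      (by rw [h0])
      (fun s hs => by
        rw [add_zero]
        exact (hop s ⟨hs.1, hs.2.le⟩ _).trans
          (mul_le_mul_of_nonneg_left (hcl_le _) (by positivity)))
      s hs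
    refine h1.trans ?_
    rw [gronwallBound_ε0, hR]
    refine mul_le_mul_of_nonneg_left (Real.exp_le_exp.2 ?_) (norm_nonneg _)
    exact mul_le_mul_of_nonneg_left (by linarith [hs.2]) (by positivity)
  have := hψ s hs
  rwa [hcl_eq _ hbound] at this

theorem linear_ode_solution_unique {n : ℕ} {M : ℝ → Matrix (Fin n) (Fin n) ℝ} {b : ℝ}
    (hM : ContinuousOn M (Icc 0 b)) {φ ψ : ℝ → Fin n → ℝ}
    (hφ : ∀ s ∈ Icc 0 b, HasDerivWithinAt φ (M s *ᵥ φ s) (Icc 0 b) s)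
    (hψ : ∀ s ∈ Icc 0 b, HasDerivWithinAt ψ (M s *ᵥ ψ s) (Icc 0 b) s)
    (h0 : φ 0 = ψ 0) : EqOn φ ψ (Icc 0 b) := by
  obtain ⟨C, hC0, hC⟩ := exists_entry_bound hM
  intro s hs
  have h1 := norm_le_gronwallBound_of_norm_deriv_right_le (f := fun s => φ s - ψ s)
    (f' := fun s => M s *ᵥ φ s - M s *ᵥ ψ s) (δ := 0) (K := n * C) (ε := 0) (a := 0) (b := b)
    (fun s hs => ((hφ s hs).sub (hψ s hs)).continuousWithinAt)
    (fun s hs => (((hφ s ⟨hs.1, hs.2.le⟩).sub (hψ s ⟨hs.1, hs.2.le⟩)).mono_of_mem_nhdsWithin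
      (Icc_mem_nhdsGE_of_mem hs)))
    (by simp [h0])
    (fun s hs => by
      rw [add_zero, ← Matrix.mulVec_sub]
      exact norm_mulVec_le hC0 (hC s ⟨hs.1, hs.2.le⟩) _)
    s hs
  rw [gronwallBound_ε0_δ0] at h1
  exact sub_eq_zero.1 (norm_le_zero_iff.1 h1)

/-- A nonautonomous linear differential equation with continuous coefficients has a solution
on the whole half-line. -/
theorem exists_linear_ode_solution {n : ℕ} {M : ℝ → Matrix (Fin n) (Fin n) ℝ}
    (hM : ContinuousOn M (Ici 0)) (v : Fin n → ℝ) :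
    ∃ ψ : ℝ → Fin n → ℝ, ψ 0 = v ∧
      ∀ s, 0 ≤ s → HasDerivWithinAt ψ (M s *ᵥ ψ s) (Ici 0) s := by
  have hMI : ∀ b, ContinuousOn M (Icc 0 b) := fun b => hM.mono Icc_subset_Ici_self
  choose φ hφ0 hφ using fun N : ℕ => exists_linear_ode_solution_Icc N.cast_nonneg (hMI N) v
  have huniq : ∀ N m : ℕ, N ≤ m → EqOn (φ m) (φ N) (Icc 0 N) := fun N m hNm => by
    have hsub : Icc (0 : ℝ) N ⊆ Icc 0 m := Icc_subset_Icc_right (by exact_mod_cast hNm)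
    exact linear_ode_solution_unique (hMI N) (fun s hs => (hφ m s (hsub hs)).mono hsub) (hφ N)
      ((hφ0 m).trans (hφ0 N).symm)
  -- The solutions on the intervals `[0, N]` agree by uniqueness, so evaluating each time on the
  -- shortest one glues them.
  set ψ : ℝ → Fin n → ℝ := fun s => φ ⌈s⌉₊ s with hψ
  have heq : ∀ N : ℕ, EqOn ψ (φ N) (Icc 0 N) := fun N s hs =>
    (huniq ⌈s⌉₊ N (Nat.ceil_le.2 hs.2) ⟨hs.1, Nat.le_ceil s⟩).symm
  refine ⟨ψ, by simpa [hψ] using hφ0 0, fun s hs => ?_⟩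
  obtain ⟨N, hN⟩ := exists_nat_gt s
  have hd := hφ N s ⟨hs, hN.le⟩
  rw [← heq N ⟨hs, hN.le⟩] at hd
  refine (hd.congr (heq N) (heq N ⟨hs, hN.le⟩)).mono_of_mem_nhdsWithin ?_
  rw [← Ici_inter_Iic]
  exact inter_mem self_mem_nhdsWithin (mem_nhdsWithin_of_mem_nhds (Iic_mem_nhds hN))

/-! ### Comparison over one dwell interval. -/

theorem clockGain_eq {n m : ℕ} (T : ℝ) (K : ℝ → Matrix (Fin m) (Fin n) ℝ) (τ : ℝ) :
    clockGain T K τ = K (min τ T) := by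
  unfold clockGain
  split_ifs with h
  · rw [min_eq_left h.le]
  · rw [min_eq_right (not_lt.1 h)]

/-- A curve of positive vectors that dominates the flow of `M` on `[0, T]`, and whose end point
dominates the flow of the frozen matrix `M T`. -/
structure IsPositiveSupersolution {n : ℕ} (T : ℝ) (M : ℝ → Matrix (Fin n) (Fin n) ℝ)
    (ξ : ℝ → Fin n → ℝ) : Prop where
  cont : ContinuousOn ξ (Icc 0 T)
  pos : ∀ τ ∈ Icc 0 T, ∀ i, 0 < ξ τ i
  deriv : ∀ τ ∈ Ioo 0 T, ∃ d, HasDerivAt ξ d τ ∧ ∀ i, (M τ *ᵥ ξ τ) i ≤ d i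
  endpoint : ∀ i, (M T *ᵥ ξ T) i ≤ 0

theorem flow_nonneg {n : ℕ} {T a b : ℝ} {M : ℝ → Matrix (Fin n) (Fin n) ℝ} {y : ℝ → Fin n → ℝ}
    (hT : 0 < T) (hM : ContinuousOn M (Icc 0 T)) (hMz : ∀ τ ∈ Icc 0 T, IsMetzler (M τ))
    (hy : ContinuousOn y (Icc a b))
    (hy' : ∀ s ∈ Ioo a b, HasDerivAt y (M (min (s - a) T) *ᵥ y s) s) (ha : ∀ i, 0 ≤ y a i) :
    ∀ s ∈ Icc a b, ∀ i, 0 ≤ y s i := by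
  obtain ⟨C, -, hC⟩ := exists_entry_bound hM
  have hmem : ∀ s ∈ Ioo a b, min (s - a) T ∈ Icc 0 T := fun s hs =>
    ⟨le_min (by linarith [hs.1]) hT.le, min_le_right _ _⟩
  exact nonneg_of_metzler_supersolution (M := fun s => M (min (s - a) T))
    (fun s hs => hMz _ (hmem s hs)) (fun s hs => hC _ (hmem s hs)) hy hy' (fun s _ i => le_rfl) ha

/-- The comparison principle is applied twice: to `c • ξ - y` while the clock runs up to `T`, then
to `c • ξ T - y` under the frozen matrix. The second works for any remaining duration because the
endpoint inequality makes a constant a supersolution. -/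
theorem IsPositiveSupersolution.le_of_flow {n : ℕ} {T a b c : ℝ}
    {M : ℝ → Matrix (Fin n) (Fin n) ℝ} {ξ y : ℝ → Fin n → ℝ} (hξ : IsPositiveSupersolution T M ξ)
    (hT : 0 < T) (hab : T ≤ b - a) (hM : ContinuousOn M (Icc 0 T))
    (hMz : ∀ τ ∈ Icc 0 T, IsMetzler (M τ)) (hc : 0 ≤ c) (hy : ContinuousOn y (Icc a b))
    (hy' : ∀ s ∈ Ioo a b, HasDerivAt y (M (min (s - a) T) *ᵥ y s) s)
    (ha : ∀ i, y a i ≤ c * ξ 0 i) :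
    ∀ s ∈ Icc a b, ∀ i, y s i ≤ c * ξ (min (s - a) T) i := by
  obtain ⟨C, -, hC⟩ := exists_entry_bound hM
  choose! d hd hle using hξ.deriv
  have hmem : ∀ s ∈ Ioo a (a + T), s - a ∈ Ioo 0 T := fun s hs =>
    ⟨by linarith [hs.1], by linarith [hs.2]⟩
  have h1 : ∀ s ∈ Icc a (a + T), ∀ i, 0 ≤ (c • ξ (s - a) - y s) i := by
    refine nonneg_of_metzler_supersolution (M := fun s => M (s - a)) (C := C)
      (w := fun s => c • d (s - a) - M (s - a) *ᵥ y s)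
      (fun s hs => hMz _ (Ioo_subset_Icc_self (hmem s hs)))
      (fun s hs => hC _ (Ioo_subset_Icc_self (hmem s hs))) ?_ ?_ ?_ ?_
    · refine ContinuousOn.sub (ContinuousOn.const_smul (hξ.cont.comp (by fun_prop) ?_) c)
        (hy.mono (Icc_subset_Icc_right (by linarith)))
      intro s hs
      exact ⟨by linarith [hs.1], by linarith [hs.2]⟩
    · intro s hs
      have h2 := hy' s ⟨hs.1, by linarith [hs.2]⟩
      rw [min_eq_left (hmem s hs).2.le] at h2
      exact (((hd _ (hmem s hs)).comp_sub_const s a).const_smul c).sub h2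
    · intro s hs i
      have := mul_le_mul_of_nonneg_left (hle _ (hmem s hs) i) hc
      simp only [Matrix.mulVec_sub, Matrix.mulVec_smul, Pi.sub_apply, Pi.smul_apply, smul_eq_mul]
      linarith
    · intro i
      simpa using ha i
  have h2 : ∀ s ∈ Icc (a + T) b, ∀ i, 0 ≤ (c • ξ T - y s) i := by
    refine nonneg_of_metzler_supersolution (M := fun _ => M T) (C := C)
      (w := fun s => 0 - M T *ᵥ y s)
      (fun s _ => hMz _ ⟨hT.le, le_rfl⟩) (fun s _ => hC _ ⟨hT.le, le_rfl⟩) ?_ ?_ ?_ ?_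
    · exact continuousOn_const.sub (hy.mono (Icc_subset_Icc_left (by linarith)))
    · intro s hs
      have h2 := hy' s ⟨by linarith [hs.1], hs.2⟩
      rw [min_eq_right (by linarith [hs.1])] at h2
      exact (hasDerivAt_const s _).sub h2
    · intro s _ i
      have := mul_le_mul_of_nonneg_left (hξ.endpoint i) hc
      simp only [Matrix.mulVec_sub, Matrix.mulVec_smul, Pi.sub_apply, Pi.smul_apply, smul_eq_mul,
        Pi.zero_apply]
      linarith
    · have := h1 (a + T) ⟨by linarith, le_rfl⟩
      simpa using this
  intro s hs i
  rcases le_total s (a + T) with h | h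
  · have := h1 s ⟨hs.1, h⟩ i
    rw [min_eq_left (by linarith)]
    simpa using this
  · have := h2 s ⟨h, hs.2⟩ i
    rw [min_eq_right (by linarith)]
    simpa using this

theorem IsPositiveSupersolution.abs_le_of_flow {n : ℕ} {T a b c : ℝ}
    {M : ℝ → Matrix (Fin n) (Fin n) ℝ} {ξ y : ℝ → Fin n → ℝ} (hξ : IsPositiveSupersolution T M ξ)
    (hT : 0 < T) (hab : T ≤ b - a) (hM : ContinuousOn M (Icc 0 T))
    (hMz : ∀ τ ∈ Icc 0 T, IsMetzler (M τ)) (hc : 0 ≤ c) (hy : ContinuousOn y (Icc a b))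
    (hy' : ∀ s ∈ Ioo a b, HasDerivAt y (M (min (s - a) T) *ᵥ y s) s)
    (ha : ∀ i, |y a i| ≤ c * ξ 0 i) :
    ∀ s ∈ Icc a b, ∀ i, |y s i| ≤ c * ξ (min (s - a) T) i := by
  intro s hs i
  refine abs_le'.2 ⟨hξ.le_of_flow hT hab hM hMz hc hy hy' (fun i => (abs_le'.1 (ha i)).1) s hs i,
    hξ.le_of_flow (y := fun s => -y s) hT hab hM hMz hc hy.neg (fun s hs => ?_)
      (fun i => (abs_le'.1 (ha i)).2) s hs i⟩
  rw [Matrix.mulVec_neg]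
  exact (hy' s hs).neg

/-- Replacing the value at the left end by the right limit turns a left-continuous flow into a
continuous one. -/
theorem exists_continuous_flow {n : ℕ} {a b : ℝ} (hab : a < b)
    {N : ℝ → Matrix (Fin n) (Fin n) ℝ} {x : ℝ → Fin n → ℝ} {x₀ : Fin n → ℝ}
    (hx : ∀ s ∈ Ioo a b, HasDerivAt x (N s *ᵥ x s) s) (hb : ContinuousWithinAt x (Iic b) b)
    (ha : Tendsto x (𝓝[>] a) (𝓝 x₀)) :
    ∃ y : ℝ → Fin n → ℝ, ContinuousOn y (Icc a b) ∧ y a = x₀ ∧ (∀ s ∈ Ioc a b, y s = x s) ∧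
      ∀ s ∈ Ioo a b, HasDerivAt y (N s *ᵥ y s) s := by
  have hne : ∀ s, a < s → Function.update x a x₀ s = x s := fun s hs =>
    Function.update_of_ne hs.ne' _ _
  have hev : ∀ s, a < s → Function.update x a x₀ =ᶠ[𝓝 s] x := fun s hs =>
    (lt_mem_nhds hs).mono hne
  refine ⟨Function.update x a x₀, fun s hs => ?_, Function.update_self _ _ _,
    fun s hs => hne s hs.1, fun s hs => ?_⟩
  · rcases hs.1.eq_or_lt with rfl | has
    · rw [continuousWithinAt_update_same]
      exact ha.mono_left (nhdsWithin_mono _ fun u hu => lt_of_le_of_ne hu.1.1 (Ne.symm hu.2))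
    · refine ContinuousWithinAt.congr_of_eventuallyEq ?_
        ((hev s has).filter_mono nhdsWithin_le_nhds) (hne s has)
      rcases hs.2.eq_or_lt with rfl | hsb
      · exact hb.mono fun u hu => hu.2
      · exact (hx s ⟨has, hsb⟩).continuousAt.continuousWithinAt
  · rw [hne s hs.1]
    exact (hx s hs).congr_of_eventuallyEq (hev s hs.1)

/-! ### Positivity and geometric decay of closed-loop trajectories. -/

section ClosedLoop

variable {n mc md : ℕ} {A : Matrix (Fin n) (Fin n) ℝ} {Bc : Matrix (Fin n) (Fin mc) ℝ}
  {J : Matrix (Fin n) (Fin n) ℝ} {Bd : Matrix (Fin n) (Fin md) ℝ} {T : ℝ}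
  {Kc : ℝ → Matrix (Fin mc) (Fin n) ℝ} {Kd : Matrix (Fin md) (Fin n) ℝ} {t : ℕ → ℝ}
  {x : ℝ → Fin n → ℝ}

theorem IsClosedLoopTrajectory.hasDerivAt (hx : IsClosedLoopTrajectory A Bc J Bd T Kc Kd t x)
    (k : ℕ) (s : ℝ) (hs : s ∈ Ioo (t k) (t (k + 1))) :
    HasDerivAt x ((A + Bc * Kc (min (s - t k) T)) *ᵥ x s) s := by
  obtain ⟨uc, ud, htr, hfb⟩ := hx
  have h := htr.flow k s hs
  have hu := hfb.cont k (s - t k) ⟨by linarith [hs.1], by linarith [hs.2]⟩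
  rw [add_sub_cancel, clockGain_eq] at hu
  rwa [hu, Matrix.mulVec_mulVec, ← Matrix.add_mulVec] at h

theorem IsClosedLoopTrajectory.leftCont (hx : IsClosedLoopTrajectory A Bc J Bd T Kc Kd t x)
    (k : ℕ) : ContinuousWithinAt x (Iic (t (k + 1))) (t (k + 1)) := by
  obtain ⟨uc, ud, htr, hfb⟩ := hx
  exact htr.leftCont k

theorem IsClosedLoopTrajectory.jump (hx : IsClosedLoopTrajectory A Bc J Bd T Kc Kd t x) (k : ℕ) :
    Tendsto x (𝓝[>] t (k + 1)) (𝓝 ((J + Bd * Kd) *ᵥ x (t (k + 1)))) := by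
  obtain ⟨uc, ud, htr, hfb⟩ := hx
  have h := htr.jump k
  rwa [hfb.disc, Matrix.mulVec_mulVec, ← Matrix.add_mulVec] at h

theorem IsClosedLoopTrajectory.start (hx : IsClosedLoopTrajectory A Bc J Bd T Kc Kd t x) :
    Tendsto x (𝓝[>] t 0) (𝓝 ((J + Bd * Kd) *ᵥ x (t 0))) ∨ Tendsto x (𝓝[>] t 0) (𝓝 (x (t 0))) := by
  obtain ⟨uc, ud, htr, hfb⟩ := hx
  have h := htr.start
  rwa [hfb.disc, Matrix.mulVec_mulVec, ← Matrix.add_mulVec] at h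

theorem HasMinDwellTime.add_mul_le (ht : HasMinDwellTime T t) (k : ℕ) : t 0 + k * T ≤ t k := by
  induction k with
  | zero => simp
  | succ k ih => push_cast; linarith [ht k]

theorem HasMinDwellTime.strictMono (hT : 0 < T) (ht : HasMinDwellTime T t) : StrictMono t :=
  strictMono_nat_of_lt_succ fun k => by linarith [ht k]

theorem HasMinDwellTime.exists_mem_Ioc (hT : 0 < T) (ht : HasMinDwellTime T t) {s : ℝ}
    (hs : t 0 < s) : ∃ k, s ∈ Ioc (t k) (t (k + 1)) := by
  have hex : ∃ m, s ≤ t m := by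
    obtain ⟨m, hm⟩ := exists_nat_gt ((s - t 0) / T)
    rw [div_lt_iff₀ hT] at hm
    exact ⟨m, by linarith [ht.add_mul_le m]⟩
  classical
  obtain ⟨k, hk⟩ : ∃ k, Nat.find hex = k + 1 :=
    Nat.exists_eq_succ_of_ne_zero fun h => by
      have := Nat.find_spec hex
      rw [h] at this
      linarith
  exact ⟨k, not_le.1 (Nat.find_min hex (by omega)), hk ▸ Nat.find_spec hex⟩

theorem mulVec_nonneg_of_isNonneg {m : ℕ} {P : Matrix (Fin n) (Fin m) ℝ} (hP : IsNonneg P)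
    {v : Fin m → ℝ} (hv : ∀ j, 0 ≤ v j) (i : Fin n) : 0 ≤ (P *ᵥ v) i := by
  change 0 ≤ ∑ j, P i j * v j
  exact Finset.sum_nonneg fun j _ => mul_nonneg (hP i j) (hv j)

theorem abs_mulVec_le_of_isNonneg {m : ℕ} {P : Matrix (Fin n) (Fin m) ℝ} (hP : IsNonneg P)
    {v w : Fin m → ℝ} (hv : ∀ j, |v j| ≤ w j) (i : Fin n) : |(P *ᵥ v) i| ≤ (P *ᵥ w) i := by
  simp only [Matrix.mulVec, dotProduct]
  refine (Finset.abs_sum_le_sum_abs _ _).trans (Finset.sum_le_sum fun j _ => ?_)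
  rw [abs_mul, abs_of_nonneg (hP i j)]
  exact mul_le_mul_of_nonneg_left (hv j) (hP i j)

theorem isPositiveSystem_closedLoop (hT : 0 < T) (ht : HasMinDwellTime T t)
    (hM : ContinuousOn (fun τ => A + Bc * Kc τ) (Icc 0 T))
    (hMz : ∀ τ ∈ Icc 0 T, IsMetzler (A + Bc * Kc τ)) (hJ : IsNonneg (J + Bd * Kd)) :
    IsPositiveSystem {x | IsClosedLoopTrajectory A Bc J Bd T Kc Kd t x} (t 0) := by
  intro x hx h0
  have hlt : ∀ k, t k < t (k + 1) := fun k => ht.strictMono hT k.lt_succ_self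
  have hseg : ∀ k x₀, Tendsto x (𝓝[>] t k) (𝓝 x₀) → (∀ i, 0 ≤ x₀ i) →
      ∀ s ∈ Ioc (t k) (t (k + 1)), ∀ i, 0 ≤ x s i := by
    intro k x₀ hlim hx₀ s hs
    obtain ⟨y, hy, hya, hyx, hy'⟩ :=
      exists_continuous_flow (hlt k) (hx.hasDerivAt k) (hx.leftCont k) hlim
    rw [← hyx s hs]
    exact flow_nonneg (M := fun τ => A + Bc * Kc τ) hT hM hMz hy hy' (by rwa [hya]) s
      (Ioc_subset_Icc_self hs)
  have hall : ∀ k, ∀ s ∈ Ioc (t k) (t (k + 1)), ∀ i, 0 ≤ x s i := by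
    intro k
    induction k with
    | zero =>
      rcases hx.start with h | h
      · exact hseg 0 _ h (mulVec_nonneg_of_isNonneg hJ h0)
      · exact hseg 0 _ h h0
    | succ k ih =>
      exact hseg _ _ (hx.jump k) (mulVec_nonneg_of_isNonneg hJ (ih _ ⟨hlt k, le_rfl⟩))
  intro s hs
  rcases hs.eq_or_lt with rfl | hs
  · exact h0
  · obtain ⟨k, hk⟩ := ht.exists_mem_Ioc hT hs
    exact hall k s hk

/-- Finitely many strict inequalities survive multiplying `w` by a factor slightly below one; this
factor becomes the decay rate per impulse. -/
theorem exists_contraction_factor {v w : Fin n → ℝ} (hvw : ∀ i, v i < w i) :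
    ∃ ρ : ℝ, 0 ≤ ρ ∧ ρ < 1 ∧ ∀ i, v i ≤ ρ * w i := by
  have h1 : ∀ᶠ ρ : ℝ in 𝓝[<] 1, ∀ i, v i < ρ * w i := by
    refine eventually_all.2 fun i => ?_
    have h : Tendsto (fun ρ : ℝ => ρ * w i) (𝓝[<] 1) (𝓝 (w i)) := by
      have : Continuous fun ρ : ℝ => ρ * w i := by fun_prop
      simpa using (this.tendsto 1).mono_left nhdsWithin_le_nhds
    exact h.eventually (lt_mem_nhds (hvw i))
  obtain ⟨ρ, hρ, hρ0, hρ1⟩ := (h1.and (Ioo_mem_nhdsLT (zero_lt_one (α := ℝ)))).exists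
  exact ⟨ρ, hρ0.le, hρ1, fun i => (hρ i).le⟩

theorem exists_dominating_factor {w : Fin n → ℝ} (hw : ∀ i, 0 < w i) :
    ∃ c : ℝ, 0 ≤ c ∧ ∀ i, 1 ≤ c * w i := by
  refine ⟨∑ i, (w i)⁻¹, Finset.sum_nonneg fun i _ => (inv_pos.2 (hw i)).le, fun i => ?_⟩
  rw [← inv_mul_cancel₀ (hw i).ne']
  exact mul_le_mul_of_nonneg_right
    (Finset.single_le_sum (f := fun i => (w i)⁻¹) (fun j _ => (inv_pos.2 (hw j)).le)
      (Finset.mem_univ i)) (hw i).le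

/-- Closed-loop trajectories contract geometrically from one dwell interval to the next. -/
theorem exists_norm_le_geometric {ξ : ℝ → Fin n → ℝ} (hT : 0 < T) (ht : HasMinDwellTime T t)
    (hM : ContinuousOn (fun τ => A + Bc * Kc τ) (Icc 0 T))
    (hMz : ∀ τ ∈ Icc 0 T, IsMetzler (A + Bc * Kc τ)) (hJ : IsNonneg (J + Bd * Kd))
    (hξ : IsPositiveSupersolution T (fun τ => A + Bc * Kc τ) ξ)
    (hjump : ∀ i, ((J + Bd * Kd) *ᵥ ξ T) i < ξ 0 i) :
    ∃ C ρ : ℝ, 0 ≤ C ∧ 0 ≤ ρ ∧ ρ < 1 ∧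
      ∀ x, IsClosedLoopTrajectory A Bc J Bd T Kc Kd t x →
        ∀ k, ∀ s ∈ Ioc (t k) (t (k + 1)), ‖x s‖ ≤ C * ρ ^ k * ‖x (t 0)‖ := by
  have h0T : (0 : ℝ) ∈ Icc 0 T := ⟨le_rfl, hT.le⟩
  have hTT : T ∈ Icc 0 T := ⟨hT.le, le_rfl⟩
  have hlt : ∀ k, t k < t (k + 1) := fun k => ht.strictMono hT k.lt_succ_self
  obtain ⟨ρ, hρ0, hρ1, hρ⟩ := exists_contraction_factor hjump
  obtain ⟨c₁, hc₁, hc₁'⟩ := exists_dominating_factor (hξ.pos 0 h0T)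
  obtain ⟨c₂, hc₂, hc₂'⟩ := exists_dominating_factor (hξ.pos T hTT)
  obtain ⟨Ξ, hΞ⟩ := isCompact_Icc.exists_bound_of_continuousOn hξ.cont
  have hΞ0 : 0 ≤ Ξ := (norm_nonneg _).trans (hΞ 0 h0T)
  refine ⟨(c₁ + c₂) * Ξ, ρ, by positivity, hρ0, hρ1, fun x hx => ?_⟩
  set r := ‖x (t 0)‖ with hr
  -- `c₁` dominates the initial state by `ξ 0`, for a start without impulse. `c₂` dominates it by `ξ
  -- T`, so that an impulse at the initial time brings it below `ξ 0`. The sum serves both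
  -- conventions.
  set c := (c₁ + c₂) * r with hc
  have hr0 : 0 ≤ r := norm_nonneg _
  have hseg : ∀ k x₀, Tendsto x (𝓝[>] t k) (𝓝 x₀) → (∀ i, |x₀ i| ≤ c * ρ ^ k * ξ 0 i) →
      ∀ s ∈ Ioc (t k) (t (k + 1)), ∀ i, |x s i| ≤ c * ρ ^ k * ξ (min (s - t k) T) i := by
    intro k x₀ hlim hx₀ s hs
    obtain ⟨y, hy, hya, hyx, hy'⟩ :=
      exists_continuous_flow (hlt k) (hx.hasDerivAt k) (hx.leftCont k) hlim
    rw [← hyx s hs]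
    exact hξ.abs_le_of_flow hT (ht k) hM hMz (by positivity) hy hy' (by rwa [hya]) s
      (Ioc_subset_Icc_self hs)
  have hx0 : ∀ i, |x (t 0) i| ≤ r := fun i => norm_le_pi_norm (x (t 0)) i
  have hξ0 := fun i => (hξ.pos 0 h0T i).le
  have hall : ∀ k, ∀ s ∈ Ioc (t k) (t (k + 1)), ∀ i,
      |x s i| ≤ c * ρ ^ k * ξ (min (s - t k) T) i := by
    intro k
    induction k with
    | zero =>
      rcases hx.start with h | h
      · refine hseg 0 _ h fun i => ?_
        have h1 : |((J + Bd * Kd) *ᵥ x (t 0)) i| ≤ ((J + Bd * Kd) *ᵥ ((c₂ * r) • ξ T)) i := by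
          refine abs_mulVec_le_of_isNonneg hJ (fun j => (hx0 j).trans ?_) i
          have := mul_le_mul_of_nonneg_right (hc₂' j) hr0
          simp only [Pi.smul_apply, smul_eq_mul]
          linarith
        rw [Matrix.mulVec_smul, Pi.smul_apply, smul_eq_mul] at h1
        have h2 := mul_le_mul_of_nonneg_left (hjump i).le (mul_nonneg hc₂ hr0)
        have h3 := mul_nonneg (mul_nonneg hc₁ hr0) (hξ0 i)
        rw [pow_zero, mul_one, hc, add_mul, add_mul]
        linarith
      · refine hseg 0 _ h fun i => ?_
        have h1 := mul_le_mul_of_nonneg_right (hc₁' i) hr0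
        have h3 := mul_nonneg (mul_nonneg hc₂ hr0) (hξ0 i)
        rw [pow_zero, mul_one, hc, add_mul, add_mul]
        linarith [hx0 i]
    | succ k ih =>
      refine hseg _ _ (hx.jump k) fun i => ?_
      have h1 : ∀ j, |x (t (k + 1)) j| ≤ ((c * ρ ^ k) • ξ T) j := fun j => by
        have := ih _ ⟨hlt k, le_rfl⟩ j
        rwa [min_eq_right (ht k)] at this
      have h2 := abs_mulVec_le_of_isNonneg hJ h1 i
      rw [Matrix.mulVec_smul, Pi.smul_apply, smul_eq_mul] at h2
      have h3 := mul_le_mul_of_nonneg_left (hρ i) (show 0 ≤ c * ρ ^ k by positivity)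
      rw [pow_succ]
      linarith
  intro k s hs
  refine (pi_norm_le_iff_of_nonneg (by positivity)).2 fun i => (hall k s hs i).trans ?_
  have hmem : min (s - t k) T ∈ Icc 0 T := ⟨le_min (by linarith [hs.1]) hT.le, min_le_right _ _⟩
  have h1 : ξ (min (s - t k) T) i ≤ Ξ :=
    (le_abs_self _).trans ((norm_le_pi_norm (ξ _) i).trans (hΞ _ hmem))
  calc c * ρ ^ k * ξ (min (s - t k) T) i ≤ c * ρ ^ k * Ξ :=
        mul_le_mul_of_nonneg_left h1 (by positivity)
    _ = (c₁ + c₂) * Ξ * ρ ^ k * r := by rw [hc]; ring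

theorem isStabilizing_of_supersolution {ξ : ℝ → Fin n → ℝ} (hT : 0 < T)
    (hK : ContinuousOn Kc (Icc 0 T))
    (hMz : ∀ τ ∈ Icc 0 T, IsMetzler (A + Bc * Kc τ)) (hJ : IsNonneg (J + Bd * Kd))
    (hξ : IsPositiveSupersolution T (fun τ => A + Bc * Kc τ) ξ)
    (hjump : ∀ i, ((J + Bd * Kd) *ᵥ ξ T) i < ξ 0 i) :
    IsStabilizing A Bc J Bd T Kc Kd := by
  have hM : ContinuousOn (fun τ => A + Bc * Kc τ) (Icc 0 T) :=
    (continuous_const.add (continuous_const.matrix_mul continuous_id)).comp_continuousOn hK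
  refine ⟨hK, fun t ht => ⟨isPositiveSystem_closedLoop hT ht hM hMz hJ, ?_, ?_⟩⟩
  all_goals obtain ⟨C, ρ, hC, hρ0, hρ1, hbound⟩ := exists_norm_le_geometric hT ht hM hMz hJ hξ hjump
  · intro ε hε
    -- The `+ 1` covers `C = 0` and also the time `t 0` itself, which lies in none of the half-open
    -- intervals of the bound.
    refine ⟨ε / (C + 1), by positivity, fun x hx hx0 s hs => ?_⟩
    rw [lt_div_iff₀ (by positivity)] at hx0
    have hn := norm_nonneg (x (t 0))
    rcases hs.eq_or_lt with rfl | hs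
    · nlinarith
    · obtain ⟨k, hk⟩ := ht.exists_mem_Ioc hT hs
      have h1 : C * ρ ^ k * ‖x (t 0)‖ ≤ C * ‖x (t 0)‖ :=
        mul_le_mul_of_nonneg_right
          (mul_le_of_le_one_right hC (pow_le_one₀ hρ0 hρ1.le)) hn
      have h2 := hbound x hx k s hk
      nlinarith
  · intro x hx
    rw [Metric.tendsto_atTop]
    intro ε hε
    have hlim : Tendsto (fun k : ℕ => C * ρ ^ k * ‖x (t 0)‖) atTop (𝓝 0) := by
      simpa using ((tendsto_pow_atTop_nhds_zero_of_lt_one hρ0 hρ1).const_mul C).mul_const ‖x (t 0)‖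
    obtain ⟨k₀, hk₀⟩ := eventually_atTop.1 (hlim.eventually (gt_mem_nhds hε))
    -- Being strictly later than `t k₀` forces the interval containing `s` to have index at least
    -- `k₀`.
    refine ⟨t k₀ + 1, fun s hs => ?_⟩
    have hmono := ht.strictMono hT
    obtain ⟨k, hk⟩ := ht.exists_mem_Ioc hT (s := s) (by linarith [hmono.monotone k₀.zero_le])
    have hlt : t k₀ < t (k + 1) := by linarith [hk.2]
    rw [dist_zero_right]
    exact (hbound x hx k s hk).trans_lt (hk₀ k (Nat.lt_succ_iff.1 (hmono.lt_iff_lt.1 hlt)))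

end ClosedLoop

/-! ### Strict supersolutions. -/

/-- A differentiable curve of positive vectors on `[0, T]` that strictly dominates the flow
of `M`. -/
structure IsStrictSupersolution {n : ℕ} (T : ℝ) (M : ℝ → Matrix (Fin n) (Fin n) ℝ)
    (ξ : ℝ → Fin n → ℝ) : Prop where
  pos : ∀ τ ∈ Icc 0 T, ∀ i, 0 < ξ τ i
  deriv : ∀ τ ∈ Icc 0 T, ∃ d, HasDerivWithinAt ξ d (Icc 0 T) τ ∧ ∀ i, (M τ *ᵥ ξ τ) i < d i
  endpoint : ∀ i, (M T *ᵥ ξ T) i < 0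

theorem IsStrictSupersolution.continuousOn {n : ℕ} {T : ℝ} {M : ℝ → Matrix (Fin n) (Fin n) ℝ}
    {ξ : ℝ → Fin n → ℝ} (h : IsStrictSupersolution T M ξ) : ContinuousOn ξ (Icc 0 T) := fun τ hτ =>
  let ⟨_, hd, _⟩ := h.deriv τ hτ
  hd.continuousWithinAt

theorem IsStrictSupersolution.isPositiveSupersolution {n : ℕ} {T : ℝ}
    {M : ℝ → Matrix (Fin n) (Fin n) ℝ} {ξ : ℝ → Fin n → ℝ} (h : IsStrictSupersolution T M ξ) :
    IsPositiveSupersolution T M ξ where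
  cont := h.continuousOn
  pos := h.pos
  deriv τ hτ :=
    let ⟨d, hd, hlt⟩ := h.deriv τ (Ioo_subset_Icc_self hτ)
    ⟨d, hd.hasDerivAt (Icc_mem_nhds hτ.1 hτ.2), fun i => (hlt i).le⟩
  endpoint i := (h.endpoint i).le

/-! ### From the transition condition to a supersolution and the linear program. -/

section Transition

variable {n mc md : ℕ} {A : Matrix (Fin n) (Fin n) ℝ} {Bc : Matrix (Fin n) (Fin mc) ℝ}
  {J : Matrix (Fin n) (Fin n) ℝ} {Bd : Matrix (Fin n) (Fin md) ℝ} {T : ℝ}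
  {Kc : ℝ → Matrix (Fin mc) (Fin n) ℝ} {Kd : Matrix (Fin md) (Fin n) ℝ}
  {Ψ : ℝ → Matrix (Fin n) (Fin n) ℝ}

theorem continuousOn_closedLoopMatrix {S : Set ℝ} (hK : ContinuousOn Kc S) :
    ContinuousOn (fun τ => A + Bc * Kc τ) S :=
  (continuous_const.add (continuous_const.matrix_mul continuous_id)).comp_continuousOn hK

/-- Column `j` is the solution starting at the `j`-th basis vector. -/
theorem exists_isTransitionMatrix (hT : 0 ≤ T) (hK : ContinuousOn Kc (Icc 0 T)) :
    ∃ Ψ, IsTransitionMatrix A Bc T Kc Ψ := by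
  have hM : ContinuousOn (fun s => A + Bc * clockGain T Kc s) (Ici 0) := by
    simp only [clockGain_eq]
    exact (continuousOn_closedLoopMatrix hK).comp (by fun_prop)
      fun s hs => ⟨le_min hs hT, min_le_right _ _⟩
  choose ψ hψ0 hψ using fun j => exists_linear_ode_solution hM (Pi.single j 1)
  refine ⟨fun s => Matrix.of fun i j => ψ j s i, ?_, fun s hs => ?_⟩
  · ext i j
    simp [hψ0, Matrix.one_apply, Pi.single_apply]
  · refine (hasDerivWithinAt_pi (E' := fun _ => Fin n → ℝ)).2 fun i =>
      hasDerivWithinAt_pi.2 fun j => ?_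
    exact hasDerivWithinAt_pi.1 (hψ j s hs) i

theorem IsTransitionMatrix.hasDerivWithinAt_mulVec (hΨ : IsTransitionMatrix A Bc T Kc Ψ)
    (v : Fin n → ℝ) {s : ℝ} (hs : s ∈ Icc 0 T) :
    HasDerivWithinAt (fun s => Ψ s *ᵥ v) ((A + Bc * Kc s) *ᵥ (Ψ s *ᵥ v)) (Icc 0 T) s := by
  have h := HasDerivWithinAt.mono (F := Fin n → Fin n → ℝ) (hΨ.2 s hs.1)
    (show Icc 0 T ⊆ Ici 0 from Icc_subset_Ici_self)
  rw [clockGain_eq, min_eq_left hs.2] at h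
  rw [Matrix.mulVec_mulVec]
  refine hasDerivWithinAt_pi.2 fun i => ?_
  have hi := (hasDerivWithinAt_pi (E' := fun _ => Fin n → ℝ)).1 h i
  simp only [Matrix.mulVec, dotProduct]
  exact HasDerivWithinAt.fun_sum fun j _ => (hasDerivWithinAt_pi.1 hi j).mul_const (v j)

theorem IsTransitionMatrix.continuousOn_mulVec (hΨ : IsTransitionMatrix A Bc T Kc Ψ)
    (v : Fin n → ℝ) : ContinuousOn (fun s => Ψ s *ᵥ v) (Icc 0 T) := fun _ hs =>
  (hΨ.hasDerivWithinAt_mulVec v hs).continuousWithinAt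

theorem IsTransitionMatrix.mulVec_le (hΨ : IsTransitionMatrix A Bc T Kc Ψ)
    (hK : ContinuousOn Kc (Icc 0 T)) (hMz : ∀ τ ∈ Icc 0 T, IsMetzler (A + Bc * Kc τ))
    {v : Fin n → ℝ} {z w : ℝ → Fin n → ℝ} (hz : ContinuousOn z (Icc 0 T))
    (hz' : ∀ s ∈ Ioo 0 T, HasDerivAt z (w s) s)
    (hw : ∀ s ∈ Ioo 0 T, ∀ i, ((A + Bc * Kc s) *ᵥ z s) i ≤ w s i) (hv : ∀ i, v i ≤ z 0 i) :
    ∀ s ∈ Icc 0 T, ∀ i, (Ψ s *ᵥ v) i ≤ z s i := by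
  obtain ⟨C, -, hC⟩ := exists_entry_bound (continuousOn_closedLoopMatrix (A := A) (Bc := Bc) hK)
  intro s hs i
  refine sub_nonneg.1 (nonneg_of_metzler_supersolution (M := fun τ => A + Bc * Kc τ)
    (z := fun s => z s - Ψ s *ᵥ v) (w := fun s => w s - (A + Bc * Kc s) *ᵥ (Ψ s *ᵥ v))
    (fun s hs => hMz s (Ioo_subset_Icc_self hs)) (fun s hs => hC s (Ioo_subset_Icc_self hs))
    (hz.sub (hΨ.continuousOn_mulVec v)) (fun s hs => ?_) (fun s hs i => ?_) (fun i => ?_) s hs i)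
  · exact (hz' s hs).sub ((hΨ.hasDerivWithinAt_mulVec v (Ioo_subset_Icc_self hs)).hasDerivAt
      (Icc_mem_nhds hs.1 hs.2))
  · rw [Matrix.mulVec_sub]
    exact sub_le_sub_right (hw s hs i) _
  · simpa [hΨ.1] using hv i

theorem IsTransitionMatrix.mulVec_nonneg (hΨ : IsTransitionMatrix A Bc T Kc Ψ)
    (hK : ContinuousOn Kc (Icc 0 T)) (hMz : ∀ τ ∈ Icc 0 T, IsMetzler (A + Bc * Kc τ))
    {v : Fin n → ℝ} (hv : ∀ i, 0 ≤ v i) {s : ℝ} (hs : s ∈ Icc 0 T) (i : Fin n) :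
    0 ≤ (Ψ s *ᵥ v) i := by
  have h := hΨ.mulVec_le hK hMz (v := -v) (z := 0) (w := 0) continuousOn_const
    (fun s _ => hasDerivAt_const s _) (fun s _ i => by simp) (fun i => by simpa using hv i) s hs i
  simpa [Matrix.mulVec_neg] using h

/-- Row sums of the coefficient matrix are at least `-n * C`, so `exp (-n * C * s)` times the vector
of ones is a subsolution and bounds the flow from below. Its negative is what the comparison takes.
-/
theorem IsTransitionMatrix.mulVec_one_pos (hΨ : IsTransitionMatrix A Bc T Kc Ψ)
    (hK : ContinuousOn Kc (Icc 0 T)) (hMz : ∀ τ ∈ Icc 0 T, IsMetzler (A + Bc * Kc τ))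
    {s : ℝ} (hs : s ∈ Icc 0 T) (i : Fin n) : 0 < (Ψ s *ᵥ (1 : Fin n → ℝ)) i := by
  obtain ⟨C, -, hC⟩ := exists_entry_bound (continuousOn_closedLoopMatrix (A := A) (Bc := Bc) hK)
  set L : ℝ := n * C with hL
  have h := hΨ.mulVec_le hK hMz (v := -1) (z := fun s => -(Real.exp (-L * s)) • (1 : Fin n → ℝ))
    (w := fun s => -(Real.exp (-L * s) * -L) • (1 : Fin n → ℝ)) (by fun_prop)
    (fun s _ => by
      have : HasDerivAt (fun s => -L * s) (-L) s := by
        simpa using (hasDerivAt_id s).const_mul (-L)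
      exact (this.exp.neg).smul_const (1 : Fin n → ℝ))
    (fun s hs i => by
      have h1 := abs_le.1 (abs_mulVec_le (hC s (Ioo_subset_Icc_self hs)) (x := (1 : Fin n → ℝ))
        (r := 1) (fun j => by simp) i)
      rw [mul_one] at h1
      have h2 := mul_le_mul_of_nonneg_left h1.1 (Real.exp_pos (-L * s)).le
      rw [Matrix.mulVec_smul]
      simp only [Pi.smul_apply, smul_eq_mul, Pi.one_apply, mul_one]
      linarith)
    (fun i => by simp) s hs i
  simp only [Matrix.mulVec_neg, Pi.neg_apply, Pi.smul_apply, smul_eq_mul, Pi.one_apply, mul_one] at h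
  exact (Real.exp_pos (-L * s)).trans_le (neg_le_neg_iff.1 h)

/-- The curve is `Ψ τ v + exp (c * (τ - T)) e` with `e = lam - Ψ T v`. The first term solves the
flow equation exactly; the second supplies the strict inequality once `c` is large, and makes the
terminal value exactly `lam`, so the endpoint condition is the hypothesis on `lam`. -/
theorem TransitionCondition.exists_strictSupersolution {lam : Fin n → ℝ} (hT : 0 < T)
    (h : TransitionCondition A Bc J Bd T lam Kc Kd) :
    ∃ ξ ε, 0 < ε ∧ IsStrictSupersolution T (fun τ => A + Bc * Kc τ) ξ ∧
      ∀ i, ((J + Bd * Kd) *ᵥ ξ T) i + ε ≤ ξ 0 i := by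
  obtain ⟨Ψ, hΨ, hneg⟩ := h.transition
  have hTT : T ∈ Icc 0 T := ⟨hT.le, le_rfl⟩
  set μ := (J + Bd * Kd) *ᵥ lam with hμ
  have hμ0 : ∀ i, 0 ≤ μ i := mulVec_nonneg_of_isNonneg h.nonneg fun j => (h.pos j).le
  -- The strict transition inequality leaves room to enlarge `μ` by `ε`; this is the margin in the
  -- jump condition.
  obtain ⟨ε, hε0, hε⟩ : ∃ ε : ℝ, 0 < ε ∧ ∀ i, (Ψ T *ᵥ (μ + ε • 1)) i < lam i := by
    have hev : ∀ᶠ ε : ℝ in 𝓝[>] 0, ∀ i, (Ψ T *ᵥ (μ + ε • 1)) i < lam i := by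
      refine eventually_all.2 fun i => ?_
      have hc : Continuous fun ε : ℝ => (Ψ T *ᵥ (μ + ε • 1)) i := by
        simp only [Matrix.mulVec_add, Matrix.mulVec_smul, Pi.add_apply, Pi.smul_apply, smul_eq_mul]
        fun_prop
      have h0 : (Ψ T *ᵥ (μ + (0 : ℝ) • 1)) i < lam i := by
        have := hneg i
        rw [Matrix.sub_mulVec, ← Matrix.mulVec_mulVec, Matrix.one_mulVec, Pi.sub_apply] at this
        rw [zero_smul, add_zero]
        linarith
      exact ((hc.tendsto 0).mono_left nhdsWithin_le_nhds).eventually (gt_mem_nhds h0)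
    obtain ⟨ε, hε, hε0⟩ := (hev.and self_mem_nhdsWithin).exists
    exact ⟨ε, hε0, hε⟩
  set v := μ + ε • (1 : Fin n → ℝ) with hv
  have hv0 : ∀ i, 0 ≤ v i := fun i => by
    simp only [hv, Pi.add_apply, Pi.smul_apply, Pi.one_apply, smul_eq_mul, mul_one]
    linarith [hμ0 i]
  set e := lam - Ψ T *ᵥ v with he
  have he0 : ∀ i, 0 < e i := fun i => sub_pos.2 (hε i)
  obtain ⟨C, hC0, hC⟩ := exists_entry_bound
    (continuousOn_closedLoopMatrix (A := A) (Bc := Bc) h.cont)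
  obtain ⟨c₀, hc₀, hc₀'⟩ := exists_dominating_factor he0
  set B : ℝ := n * C * ‖e‖ with hB
  have hB0 : 0 ≤ B := by positivity
  -- Since `c₀ * e i ≥ 1`, each `c * e i` is at least `B + 1`, whereas the coefficient matrix sends
  -- `e` to entries at most `B`.
  set c := c₀ * (B + 1) with hc
  have hce : ∀ τ ∈ Icc 0 T, ∀ i, ((A + Bc * Kc τ) *ᵥ e) i < c * e i := fun τ hτ i => by
    have h1 := (abs_le.1 (abs_mulVec_le (hC τ hτ) (fun j => norm_le_pi_norm e j) i)).2
    have h2 := mul_le_mul_of_nonneg_right (hc₀' i) (show 0 ≤ B + 1 by linarith)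
    have h3 : c * e i = c₀ * e i * (B + 1) := by rw [hc]; ring
    linarith
  have hξT : Ψ T *ᵥ v + Real.exp (c * (T - T)) • e = lam := by
    simp [he]
  refine ⟨fun τ => Ψ τ *ᵥ v + Real.exp (c * (τ - T)) • e, ε, hε0, ⟨fun τ hτ i => ?_,
    fun τ hτ => ?_, fun i => ?_⟩, fun i => ?_⟩
  · exact add_pos_of_nonneg_of_pos (hΨ.mulVec_nonneg h.cont h.metzler hv0 hτ i)
      (mul_pos (Real.exp_pos _) (he0 i))
  · refine ⟨(A + Bc * Kc τ) *ᵥ (Ψ τ *ᵥ v) + (Real.exp (c * (τ - T)) * c) • e, ?_, fun i => ?_⟩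
    · refine (hΨ.hasDerivWithinAt_mulVec v hτ).add (HasDerivAt.hasDerivWithinAt ?_)
      have : HasDerivAt (fun τ => c * (τ - T)) c τ := by
        simpa using ((hasDerivAt_id τ).sub_const T).const_mul c
      exact this.exp.smul_const e
    · have := mul_lt_mul_of_pos_left (hce τ hτ i) (Real.exp_pos (c * (τ - T)))
      simp only [Matrix.mulVec_add, Matrix.mulVec_smul, Pi.add_apply, Pi.smul_apply, smul_eq_mul]
      linarith
  · simp only [hξT]
    exact h.flow i
  · simp only [hξT, hΨ.1, Matrix.one_mulVec]
    have := mul_pos (Real.exp_pos (c * (0 - T))) (he0 i)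
    simp only [hv, Pi.add_apply, Pi.smul_apply, Pi.one_apply, smul_eq_mul, mul_one]
    linarith

theorem TransitionCondition.exists_lpCondition {lam : Fin n → ℝ} (hT : 0 < T)
    (h : TransitionCondition A Bc J Bd T lam Kc Kd) :
    ∃ X U Ud ε α, LPCondition A Bc J Bd T X U Ud ε α := by
  obtain ⟨ξ, ε, hε, hξ, hjump⟩ := h.exists_strictSupersolution hT
  have hTT : T ∈ Icc 0 T := ⟨hT.le, le_rfl⟩
  obtain ⟨C, hC0, hC⟩ := exists_entry_bound
    (continuousOn_closedLoopMatrix (A := A) (Bc := Bc) h.cont)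
  obtain ⟨Ξ, hΞ⟩ := isCompact_Icc.exists_bound_of_continuousOn hξ.continuousOn
  have hΞ0 : 0 ≤ Ξ := (norm_nonneg _).trans (hΞ T hTT)
  have hmul : ∀ τ, A * Matrix.diagonal (ξ τ) + Bc * (Kc τ * Matrix.diagonal (ξ τ)) =
      (A + Bc * Kc τ) * Matrix.diagonal (ξ τ) := fun τ => by
    rw [Matrix.add_mul, Matrix.mul_assoc]
  have hmul' : J * Matrix.diagonal (ξ T) + Bd * (Kd * Matrix.diagonal (ξ T)) =
      (J + Bd * Kd) * Matrix.diagonal (ξ T) := by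
    rw [Matrix.add_mul, Matrix.mul_assoc]
  have hone : ∀ w : Fin n → ℝ, Matrix.diagonal w *ᵥ (1 : Fin n → ℝ) = w := fun w => by
    ext i; simp [Matrix.mulVec_diagonal]
  have hdiag : Continuous fun w : Fin n → ℝ => Matrix.diagonal w :=
    continuous_id.matrix_diagonal
  have hder : ∀ τ d, HasDerivWithinAt ξ d (Icc 0 T) τ →
      HasDerivWithinAt (fun τ => Matrix.diagonal (ξ τ)) (Matrix.diagonal d) (Icc 0 T) τ := by
    intro τ d hd
    refine (hasDerivWithinAt_pi (E' := fun _ => Fin n → ℝ)).2 fun i =>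
      hasDerivWithinAt_pi.2 fun j => ?_
    by_cases hij : i = j
    · subst hij
      simpa using hasDerivWithinAt_pi.1 hd i
    · simpa [Matrix.diagonal_apply_ne _ hij] using hasDerivWithinAt_const τ (Icc 0 T) (0 : ℝ)
  -- Right multiplication by `diag ξ` scales columns by positive numbers, so off-diagonal signs are
  -- kept. Diagonal entries are at least `-C * Ξ`, which `α` compensates; the `+ 1` keeps `α`
  -- positive.
  refine ⟨fun τ => Matrix.diagonal (ξ τ), fun τ => Kc τ * Matrix.diagonal (ξ τ),
    Kd * Matrix.diagonal (ξ T), ε, C * Ξ + 1, ?_⟩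
  refine
    { diag := fun τ _ => Matrix.isDiag_diagonal _
      diff := fun τ hτ =>
        let ⟨d, hd, _⟩ := hξ.deriv τ hτ
        HasDerivWithinAt.differentiableWithinAt (F := Fin n → Fin n → ℝ) (hder τ d hd)
      cont := fun τ hτ => ?_
      unit := fun τ hτ => ?_
      pos := fun i => by simpa using hξ.pos T hTT i
      eps_pos := hε
      alpha_pos := by positivity
      metzler := fun τ hτ i j => ?_
      nonneg := fun i j => ?_
      flow_end := fun i => ?_
      flow := fun τ hτ i => ?_
      jump := fun i => ?_ }
  · exact Filter.Tendsto.comp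
      ((continuous_fst.matrix_mul continuous_snd).tendsto (Kc τ, Matrix.diagonal (ξ τ)))
      ((h.cont τ hτ).prodMk_nhds ((hdiag.comp_continuousOn hξ.continuousOn) τ hτ))
  · rw [Matrix.isUnit_diagonal, Pi.isUnit_iff]
    exact fun i => (hξ.pos τ hτ i).ne'.isUnit
  · rw [hmul, Matrix.add_apply, Matrix.mul_diagonal, Matrix.smul_apply, smul_eq_mul]
    by_cases hij : i = j
    · subst hij
      rw [Matrix.one_apply_eq, mul_one]
      have h1 : |(A + Bc * Kc τ) i i * ξ τ i| ≤ C * Ξ := by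
        rw [abs_mul]
        exact mul_le_mul (hC τ hτ i i) ((norm_le_pi_norm (ξ τ) i).trans (hΞ τ hτ))
          (abs_nonneg _) hC0
      linarith [(abs_le.1 h1).1]
    · rw [Matrix.one_apply_ne hij, mul_zero, add_zero]
      exact mul_nonneg (h.metzler τ hτ i j hij) (hξ.pos τ hτ j).le
  · rw [hmul', Matrix.mul_diagonal]
    exact mul_nonneg (h.nonneg i j) (hξ.pos T hTT j).le
  · rw [hmul, ← Matrix.mulVec_mulVec, hone]
    exact hξ.endpoint i
  · obtain ⟨d, hd, hlt⟩ := hξ.deriv τ hτ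
    have hX : derivWithin (fun τ => Matrix.diagonal (ξ τ)) (Icc 0 T) τ = Matrix.diagonal d :=
      HasDerivWithinAt.derivWithin (F := Fin n → Fin n → ℝ) (hder τ d hd)
        (uniqueDiffOn_Icc hT τ hτ)
    rw [hX, add_assoc, hmul, Matrix.add_mulVec,
      ← Matrix.mulVec_mulVec, hone, Matrix.neg_mulVec, hone, Pi.add_apply, Pi.neg_apply]
    linarith [hlt i]
  · rw [hmul', Matrix.add_mulVec, Matrix.sub_mulVec, ← Matrix.mulVec_mulVec, hone, hone,
      Matrix.smul_mulVec, Matrix.one_mulVec]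
    simp only [Pi.add_apply, Pi.sub_apply, Pi.smul_apply, Pi.one_apply, smul_eq_mul, mul_one]
    linarith [hjump i]

theorem TransitionCondition.isStabilizing {lam : Fin n → ℝ} (hT : 0 < T)
    (h : TransitionCondition A Bc J Bd T lam Kc Kd) : IsStabilizing A Bc J Bd T Kc Kd := by
  obtain ⟨ξ, ε, hε, hξ, hjump⟩ := h.exists_strictSupersolution hT
  exact isStabilizing_of_supersolution hT h.cont h.metzler h.nonneg hξ.isPositiveSupersolution
    fun i => by linarith [hjump i]

end Transition

/-! ### From the linear program to a supersolution and the transition condition. -/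

section LinearProgram

variable {n mc md : ℕ} {A : Matrix (Fin n) (Fin n) ℝ} {Bc : Matrix (Fin n) (Fin mc) ℝ}
  {J : Matrix (Fin n) (Fin n) ℝ} {Bd : Matrix (Fin n) (Fin md) ℝ} {T : ℝ}
  {X : ℝ → Matrix (Fin n) (Fin n) ℝ} {U : ℝ → Matrix (Fin mc) (Fin n) ℝ}
  {Ud : Matrix (Fin md) (Fin n) ℝ} {ε α : ℝ}

namespace LPCondition

theorem eq_diagonal (h : LPCondition A Bc J Bd T X U Ud ε α) {τ : ℝ} (hτ : τ ∈ Icc 0 T) :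
    X τ = Matrix.diagonal fun i => X τ i i := by
  conv_lhs => rw [← (h.diag τ hτ).diagonal_diag]
  rfl

theorem hasDerivWithinAt (h : LPCondition A Bc J Bd T X U Ud ε α) {τ : ℝ} (hτ : τ ∈ Icc 0 T) :
    HasDerivWithinAt (F := Fin n → Fin n → ℝ) X (derivWithin X (Icc 0 T) τ) (Icc 0 T) τ :=
  DifferentiableWithinAt.hasDerivWithinAt (F := Fin n → Fin n → ℝ) (h.diff τ hτ)

theorem hasDerivWithinAt_diag (h : LPCondition A Bc J Bd T X U Ud ε α) {τ : ℝ}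
    (hτ : τ ∈ Icc 0 T) :
    HasDerivWithinAt (fun τ i => X τ i i) (fun i => derivWithin X (Icc 0 T) τ i i) (Icc 0 T) τ := by
  have hd := h.hasDerivWithinAt hτ
  exact hasDerivWithinAt_pi.2 fun i => hasDerivWithinAt_pi.1
    ((hasDerivWithinAt_pi (E' := fun _ => Fin n → ℝ)).1 hd i) i

/-- Needed so that the derivative of `X` applied to the ones vector is the derivative of the
diagonal curve. -/
theorem derivWithin_apply_ne (h : LPCondition A Bc J Bd T X U Ud ε α) (hT : 0 < T) {τ : ℝ}
    (hτ : τ ∈ Icc 0 T) {i j : Fin n} (hij : i ≠ j) : derivWithin X (Icc 0 T) τ i j = 0 := by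
  have hd := h.hasDerivWithinAt hτ
  have h1 := hasDerivWithinAt_pi.1 ((hasDerivWithinAt_pi (E' := fun _ => Fin n → ℝ)).1 hd i) j
  have h2 : HasDerivWithinAt (fun τ => X τ i j) 0 (Icc 0 T) τ :=
    (hasDerivWithinAt_const τ _ (0 : ℝ)).congr (fun s hs => h.diag s hs hij) (h.diag τ hτ hij)
  exact (uniqueDiffOn_Icc hT τ hτ).eq_deriv _ h1 h2

theorem diag_ne_zero (h : LPCondition A Bc J Bd T X U Ud ε α) {τ : ℝ} (hτ : τ ∈ Icc 0 T)
    (i : Fin n) : X τ i i ≠ 0 := by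
  have hu := h.unit τ hτ
  rw [h.eq_diagonal hτ, Matrix.isUnit_diagonal, Pi.isUnit_iff] at hu
  exact (hu i).ne_zero

theorem continuousOn_diag (h : LPCondition A Bc J Bd T X U Ud ε α) :
    ContinuousOn (fun τ i => X τ i i) (Icc 0 T) := fun _ hτ =>
  (h.hasDerivWithinAt_diag hτ).continuousWithinAt

/-- Positivity is assumed only at `T`. By the intermediate value theorem a nonpositive entry earlier
would force a zero, contradicting nonsingularity. -/
theorem diag_pos (h : LPCondition A Bc J Bd T X U Ud ε α) {τ : ℝ} (hτ : τ ∈ Icc 0 T)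
    (i : Fin n) : 0 < X τ i i := by
  by_contra hneg
  have hc : ContinuousOn (fun τ => X τ i i) (Icc τ T) :=
    ((continuousOn_pi.1 h.continuousOn_diag) i).mono (Icc_subset_Icc_left hτ.1)
  obtain ⟨s, hs, hs0⟩ := intermediate_value_Icc hτ.2 hc ⟨not_lt.1 hneg, (h.pos i).le⟩
  exact h.diag_ne_zero ⟨hτ.1.trans hs.1, hs.2⟩ i hs0

theorem mulVec_one (h : LPCondition A Bc J Bd T X U Ud ε α) {τ : ℝ} (hτ : τ ∈ Icc 0 T) :
    X τ *ᵥ (1 : Fin n → ℝ) = fun i => X τ i i := by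
  rw [h.eq_diagonal hτ]
  ext i
  simp [Matrix.mulVec_diagonal]

theorem add_mul_gain_mul {m p : ℕ} (h : LPCondition A Bc J Bd T X U Ud ε α) {τ : ℝ}
    (hτ : τ ∈ Icc 0 T) (P : Matrix (Fin p) (Fin n) ℝ) (Q : Matrix (Fin p) (Fin m) ℝ)
    (V : Matrix (Fin m) (Fin n) ℝ) : (P + Q * (V * (X τ)⁻¹)) * X τ = P * X τ + Q * V := by
  have hdet := (Matrix.isUnit_iff_isUnit_det _).1 (h.unit τ hτ)
  rw [Matrix.add_mul, Matrix.mul_assoc, Matrix.mul_assoc, Matrix.nonsing_inv_mul _ hdet,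
    Matrix.mul_one]

theorem mul_diag_apply (h : LPCondition A Bc J Bd T X U Ud ε α) {τ : ℝ} (hτ : τ ∈ Icc 0 T)
    {p : ℕ} (P : Matrix (Fin p) (Fin n) ℝ) (i : Fin p) (j : Fin n) :
    (P * X τ) i j = P i j * X τ j j := by
  conv_lhs => rw [h.eq_diagonal hτ]
  rw [Matrix.mul_diagonal]

/-- The `α` shift touches only the diagonal, and off it a positive column factor can be cancelled.
-/
theorem isMetzler_gain (h : LPCondition A Bc J Bd T X U Ud ε α) {τ : ℝ} (hτ : τ ∈ Icc 0 T) :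
    IsMetzler (A + Bc * (U τ * (X τ)⁻¹)) := by
  intro i j hij
  have h1 := h.metzler τ hτ i j
  rw [← h.add_mul_gain_mul hτ, Matrix.add_apply, h.mul_diag_apply hτ, Matrix.smul_apply,
    Matrix.one_apply_ne hij, smul_zero, add_zero] at h1
  exact nonneg_of_mul_nonneg_left h1 (h.diag_pos hτ j)

theorem isNonneg_gain (h : LPCondition A Bc J Bd T X U Ud ε α) (hT : 0 < T) :
    IsNonneg (J + Bd * (Ud * (X T)⁻¹)) := by
  intro i j
  have hTT : T ∈ Icc 0 T := ⟨hT.le, le_rfl⟩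
  have h1 := h.nonneg i j
  rw [← h.add_mul_gain_mul hTT, h.mul_diag_apply hTT] at h1
  exact nonneg_of_mul_nonneg_left h1 (h.diag_pos hTT j)

theorem continuousOn_gain (h : LPCondition A Bc J Bd T X U Ud ε α) :
    ContinuousOn (fun τ => U τ * (X τ)⁻¹) (Icc 0 T) := by
  have hX : ContinuousOn X (Icc 0 T) :=
    fun τ hτ => HasDerivWithinAt.continuousWithinAt (F := Fin n → Fin n → ℝ) (h.hasDerivWithinAt hτ)
  intro τ hτ
  have hdet := ((Matrix.isUnit_iff_isUnit_det _).1 (h.unit τ hτ)).ne_zero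
  have hinv : ContinuousAt Inv.inv (X τ) := by
    refine continuousAt_matrix_inv _ ?_
    rw [Ring.inverse_eq_inv']
    exact continuousAt_inv₀ hdet
  have hXi : ContinuousWithinAt (fun τ => (X τ)⁻¹) (Icc 0 T) τ :=
    hinv.comp_continuousWithinAt (hX τ hτ)
  exact Filter.Tendsto.comp
    ((continuous_fst.matrix_mul continuous_snd).tendsto (U τ, (X τ)⁻¹))
    ((h.cont τ hτ).prodMk_nhds hXi)

theorem isStrictSupersolution (h : LPCondition A Bc J Bd T X U Ud ε α) (hT : 0 < T) :
    IsStrictSupersolution T (fun τ => A + Bc * (U τ * (X τ)⁻¹)) (fun τ i => X τ i i) where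
  pos τ hτ i := h.diag_pos hτ i
  deriv τ hτ := by
    refine ⟨_, h.hasDerivWithinAt_diag hτ, fun i => ?_⟩
    have h1 := h.flow τ hτ i
    have h2 : (derivWithin X (Icc 0 T) τ *ᵥ (1 : Fin n → ℝ)) i =
        derivWithin X (Icc 0 T) τ i i := by
      simp only [Matrix.mulVec, dotProduct, Pi.one_apply, mul_one]
      exact Finset.sum_eq_single i
        (fun j _ hj => h.derivWithin_apply_ne hT hτ hj.symm) (by simp)
    rw [add_assoc, ← h.add_mul_gain_mul hτ, Matrix.add_mulVec, Matrix.neg_mulVec,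
      ← Matrix.mulVec_mulVec, h.mulVec_one hτ, Pi.add_apply, Pi.neg_apply, h2] at h1
    linarith
  endpoint i := by
    have hTT : T ∈ Icc 0 T := ⟨hT.le, le_rfl⟩
    have h1 := h.flow_end i
    rwa [← h.add_mul_gain_mul hTT, ← Matrix.mulVec_mulVec, h.mulVec_one hTT] at h1

theorem jump_le (h : LPCondition A Bc J Bd T X U Ud ε α) (hT : 0 < T) (i : Fin n) :
    ((J + Bd * (Ud * (X T)⁻¹)) *ᵥ fun i => X T i i) i + ε ≤ X 0 i i := by
  have hTT : T ∈ Icc 0 T := ⟨hT.le, le_rfl⟩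
  have h1 := h.jump i
  rw [← h.add_mul_gain_mul hTT, Matrix.add_mulVec, Matrix.sub_mulVec, ← Matrix.mulVec_mulVec,
    h.mulVec_one hTT, h.mulVec_one ⟨le_rfl, hT.le⟩, Matrix.smul_mulVec, Matrix.one_mulVec] at h1
  simp only [Pi.add_apply, Pi.sub_apply, Pi.smul_apply, Pi.one_apply, smul_eq_mul, mul_one] at h1
  linarith

theorem isStabilizing (h : LPCondition A Bc J Bd T X U Ud ε α) (hT : 0 < T) :
    IsStabilizing A Bc J Bd T (fun τ => U τ * (X τ)⁻¹) (Ud * (X T)⁻¹) :=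
  isStabilizing_of_supersolution hT h.continuousOn_gain (fun _ hτ => h.isMetzler_gain hτ)
    (h.isNonneg_gain hT) (h.isStrictSupersolution hT).isPositiveSupersolution
    fun i => by linarith [h.jump_le hT i, h.eps_pos]

theorem transitionCondition (h : LPCondition A Bc J Bd T X U Ud ε α) (hT : 0 < T) :
    TransitionCondition A Bc J Bd T (fun i => X T i i) (fun τ => U τ * (X τ)⁻¹)
      (Ud * (X T)⁻¹) := by
  have hTT : T ∈ Icc 0 T := ⟨hT.le, le_rfl⟩
  have hξ := (h.isStrictSupersolution hT).isPositiveSupersolution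
  have hMz := fun τ (hτ : τ ∈ Icc 0 T) => h.isMetzler_gain hτ
  obtain ⟨Ψ, hΨ⟩ := exists_isTransitionMatrix (A := A) (Bc := Bc) hT.le h.continuousOn_gain
  refine ⟨h.continuousOn_gain, h.pos, hMz, h.isNonneg_gain hT,
    (h.isStrictSupersolution hT).endpoint, Ψ, hΨ, fun i => ?_⟩
  choose! d hd hle using hξ.deriv
  have h1 := hΨ.mulVec_le h.continuousOn_gain hMz hξ.cont hd hle
    (v := ((J + Bd * (Ud * (X T)⁻¹)) *ᵥ fun i => X T i i) + ε • 1)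
    (fun i => by simpa using h.jump_le hT i) T hTT i
  -- The comparison is only a weak inequality; strictness comes from the term `ε • Ψ T 1`, which is
  -- positive in every coordinate.
  have h2 := mul_pos h.eps_pos (hΨ.mulVec_one_pos h.continuousOn_gain hMz hTT i)
  rw [Matrix.mulVec_add, Matrix.mulVec_smul, Pi.add_apply, Pi.smul_apply, smul_eq_mul] at h1
  rw [Matrix.sub_mulVec, ← Matrix.mulVec_mulVec, Matrix.one_mulVec, Pi.sub_apply]
  linarith

end LPCondition

end LinearProgram

end ImpulsiveStabilization

theorem theorem8 {n mc md : ℕ} (A : Matrix (Fin n) (Fin n) ℝ)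
    (Bc : Matrix (Fin n) (Fin mc) ℝ) (J : Matrix (Fin n) (Fin n) ℝ)
    (Bd : Matrix (Fin n) (Fin md) ℝ) (T : ℝ) (hT : 0 < T) :
    ((∃ lam Kc Kd, ImpulsiveStabilization.TransitionCondition A Bc J Bd T lam Kc Kd) ↔
      (∃ X U Ud ε α, ImpulsiveStabilization.LPCondition A Bc J Bd T X U Ud ε α)) ∧
    (((∃ lam Kc Kd, ImpulsiveStabilization.TransitionCondition A Bc J Bd T lam Kc Kd) ∨
      (∃ X U Ud ε α, ImpulsiveStabilization.LPCondition A Bc J Bd T X U Ud ε α)) →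
      ∃ Kc Kd, ImpulsiveStabilization.IsStabilizing A Bc J Bd T Kc Kd) ∧
    (∀ lam Kc Kd, ImpulsiveStabilization.TransitionCondition A Bc J Bd T lam Kc Kd →
      ImpulsiveStabilization.IsStabilizing A Bc J Bd T Kc Kd) ∧
    (∀ X U Ud ε α, ImpulsiveStabilization.LPCondition A Bc J Bd T X U Ud ε α →
      ImpulsiveStabilization.IsStabilizing A Bc J Bd T
        (fun τ => U τ * (X τ)⁻¹) (Ud * (X T)⁻¹)) := by
  refine ⟨⟨?_, ?_⟩, ?_, fun lam Kc Kd h => h.isStabilizing hT,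
    fun X U Ud ε α h => h.isStabilizing hT⟩
  · rintro ⟨lam, Kc, Kd, h⟩
    exact h.exists_lpCondition hT
  · rintro ⟨X, U, Ud, ε, α, h⟩
    exact ⟨_, _, _, h.transitionCondition hT⟩
  · rintro (⟨lam, Kc, Kd, h⟩ | ⟨X, U, Ud, ε, α, h⟩)
    · exact ⟨Kc, Kd, h.isStabilizing hT⟩
    · exact ⟨_, _, h.isStabilizing hT⟩
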